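/- Let $p_0,p_1,\dots,p_J\in\mathbf R^K_+$ be price vectors with budgets $\mathcal B_j=\{y\in\mathbf R^K_+:p_j'y=1\}$, $j=0,\dots,J$. For $j=1,\dots,J$ let $P_j$ be a probability distribution on $\mathcal B_j$ (the observed demand); $\mathcal B_0$ is a counterfactual budget. *Rationalizability.* For a locally nonsatiated utility function $u:\mathbf R^K_+\to\mathbf R$ let $\operatorname{argmax}_j(u)$ be the set of maximizers of $u$ over $\{y\in\mathbf R^K_+:p_j'y\le 1\}$; by local nonsatiation it is contained in $\mathcal B_j$. A tuple $(d_0,\dots,d_J)$ of bundles is a rationalizable nonstochastic demand system if there is a locally nonsatiated $u$ with $d_j\in\operatorname{argmax}_j(u)$ for all $j$. Distributions $(P_0,\dots,P_J)$ are jointly rationalizable if there are a probability distribution $P_u$ over locally nonsatiated utility functions and measurable demands $y_j(u)$, with $y_j(u)\in\operatorname{argmax}_j(u)$ for all $j$ for $P_u$-almost every $u$, such that $P_j(x)=P_u(\{u:y_j(u)\in x\})$ for every $j$ and every Borel set $x$. *Patches.* The patches of the augmented budget system $(\mathcal B_0,\dots,\mathcal B_J)$ are the classes of the partition of $\bigcup_{j=0}^J\mathcal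 B_j$ in which $y_1,y_2$ are equivalent iff $\operatorname{sg}(p_j'y_1-1)=\operatorname{sg}(p_j'y_2-1)$ for all $j=0,\dots,J$. Let $x^*_{1|j},\dots,x^*_{I^*_j|j}$ be the patches contained in $\mathcal B_j$. The vector representation of $(P_0,\dots,P_J)$ is $(\pi_0^*,\pi_1^*)$, where $\pi_0^*=(P_0(x^*_{i|0}))_{i\le I_0^*}$ and $\pi_1^*=(P_j(x^*_{i|j}))_{1\le j\le J,\ i\le I^*_j}$. The columns of the rational demand matrix $A^*$ are the finitely many distinct ($0/1$-valued) vector representations of the rationalizable nonstochastic demand systems, regarded as systems of point masses. Let $H^*$ be their number and $\Delta^{H^*-1}$ the unit simplex in $\mathbf R^{H^*}$. **Theorem.** A probability distribution $P_0$ on $\mathcal B_0$ is consistent with the observed demands $(P_1,\dots,P_J)$, i.e. $(P_0,P_1,\dots,P_J)$ are jointly rationalizable, if and only if $$A^*\nu^*=\begin{bmatrix}\pi_0^*\\ \pi_1^*\end{bmatrix}\quad\text{for some }\nu^*\in\Delta^{H^*-1},$$ where $\pi_0^*$ and $\pi_1^*$ are the values implied by $P_0$ and by $(P_1,\dots,P_J)$.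 In particular, the conditional distributions $P_0(\cdot\mid y\in x^*_{i|0})$ are not restricted: if $P_0$ is consistent and, for every $i$ with $P_0(x^*_{i|0})>0$, $Q_i$ is any probability distribution on $x^*_{i|0}$, then there is a consistent $P_0'$ on $\mathcal B_0$ with $P_0'(x^*_{i|0})=P_0(x^*_{i|0})$ for all $i$ and $P_0'(\cdot\mid y\in x^*_{i|0})=Q_i$ for all $i$ with $P_0(x^*_{i|0})>0$. -/

import Mathlib

open MeasureTheory ProbabilityTheory Matrix

namespace RandomUtility

/-- The nonnegative orthant of consumption bundles. -/
abbrev Bundle (K : ℕ) : Type := {y : Fin K → ℝ // 0 ≤ y}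

/-- Locally nonsatiated utility functions on the nonnegative orthant. -/
structure Utility (K : ℕ) where
  /-- the utility of a bundle -/
  toFun : Bundle K → ℝ
  /-- local nonsatiation: arbitrarily close to every bundle there is a strictly better one -/
  nonsatiated : ∀ y : Bundle K, ∀ ε > 0, ∃ z : Bundle K, dist z y < ε ∧ toFun y < toFun z

/-- The budget plane at prices `q`, with expenditure normalized to one. -/
def budget {K : ℕ} (q : Fin K → ℝ) : Set (Fin K → ℝ) :=
  {y | 0 ≤ y ∧ q ⬝ᵥ y = 1}

/-- The set of utility maximizing bundles of a consumer with utility `u` who faces prices `q` and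
has one unit to spend. By local nonsatiation all of them lie on the budget plane, see
`argmax_subset_budget`. -/
def argmax {K : ℕ} (u : Utility K) (q : Fin K → ℝ) : Set (Fin K → ℝ) :=
  {y | ∃ hy : 0 ≤ y, q ⬝ᵥ y ≤ 1 ∧
    ∀ (z : Fin K → ℝ) (hz : 0 ≤ z), q ⬝ᵥ z ≤ 1 → u.toFun ⟨z, hz⟩ ≤ u.toFun ⟨y, hy⟩}

theorem argmax_subset_budget {K : ℕ} (u : Utility K) (q : Fin K → ℝ) :
    argmax u q ⊆ budget q := by
  rintro y ⟨hy, hle, hmax⟩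
  refine ⟨hy, le_antisymm hle (not_lt.1 fun hlt => ?_)⟩
  have hc : Continuous fun z : Bundle K => q ⬝ᵥ (z : Fin K → ℝ) :=
    continuous_const.dotProduct continuous_subtype_val
  have hev := (hc.continuousAt (x := (⟨y, hy⟩ : Bundle K))).eventually_lt
    (continuousAt_const (y := (1 : ℝ))) hlt
  obtain ⟨ε, hε, hball⟩ := Metric.eventually_nhds_iff.1 hev
  obtain ⟨z, hz, hlt'⟩ := u.nonsatiated ⟨y, hy⟩ ε hε
  exact absurd hlt' (not_lt.2 (hmax z.1 z.2 (hball hz).le))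

/-- A nonstochastic demand system `d`, one bundle for each budget, is rationalizable if a single
utility function makes every `d j` utility maximizing on its budget. -/
def NonstochRationalizable {K : ℕ} {ι : Type} (p : ι → Fin K → ℝ) (d : ι → Fin K → ℝ) : Prop :=
  ∃ u : Utility K, ∀ j, d j ∈ argmax u (p j)

/-- A stochastic demand system `P` on the budgets with prices `p` is rationalizable by a random
utility model: there are a distribution `Pu` over utility functions and, for every budget `j`, a
demand `y j u` of the consumer with utility `u`, which is a maximizer of `u` on that budget, such
that `P j` is the distribution of `y j u` when `u` is drawn from `Pu`.
The space of utility functions may carry any σ-algebra for which the demands are measurable. -/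
def StochRationalizable {K : ℕ} {ι : Type} (p : ι → Fin K → ℝ)
    (P : ι → Measure (Fin K → ℝ)) : Prop :=
  ∃ (_ : MeasurableSpace (Utility K)) (Pu : Measure (Utility K))
    (y : ι → Utility K → Fin K → ℝ),
    IsProbabilityMeasure Pu ∧
    (∀ j, Measurable (y j)) ∧
    (∀ᵐ u ∂Pu, ∀ j, y j u ∈ argmax u (p j)) ∧
    ∀ j, ∀ x : Set (Fin K → ℝ), MeasurableSet x → P j x = Pu {u | y j u ∈ x}

/-- For every budget, whether `y` is strictly below, on, or strictly above its plane. -/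
noncomputable def position {K : ℕ} {ι : Type} (p : ι → Fin K → ℝ) (y : Fin K → ℝ) :
    ι → SignType :=
  fun j => SignType.sign (p j ⬝ᵥ y - 1)

/-- The patches of a budget system: the classes of the partition of the union of all budgets in
which two bundles are equivalent iff they have the same position relative to every budget. -/
def patches {K : ℕ} {ι : Type} (p : ι → Fin K → ℝ) : Set (Set (Fin K → ℝ)) :=
  {x | ∃ y ∈ ⋃ j, budget (p j), x = {z ∈ ⋃ j, budget (p j) | position p z = position p y}}

/-- The patches that comprise budget `j`. -/
abbrev PatchOn {K : ℕ} {ι : Type} (p : ι → Fin K → ℝ) (j : ι) : Type :=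
  {x : Set (Fin K → ℝ) // x ∈ patches p ∧ x ⊆ budget (p j)}

/-- The index set of vector representations: the patches of all budgets, budget by budget. A patch
that lies on several budgets appears once for each of them. -/
abbrev Row {K : ℕ} {ι : Type} (p : ι → Fin K → ℝ) : Type := Σ j : ι, PatchOn p j

/-- The vector representation of a stochastic demand system: its patch probabilities. -/
noncomputable def vectorRep {K : ℕ} {ι : Type} (p : ι → Fin K → ℝ)
    (P : ι → Measure (Fin K → ℝ)) : Row p → ℝ :=
  fun r => (P r.1).real r.2.1

/-- The vector representations of the rationalizable nonstochastic demand systems, these being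
regarded as degenerate stochastic demand systems. -/
def rationalTypes {K : ℕ} {ι : Type} (p : ι → Fin K → ℝ) : Set (Row p → ℝ) :=
  {a | ∃ d : ι → Fin K → ℝ, NonstochRationalizable p d ∧
    a = vectorRep p fun j => Measure.dirac (d j)}

theorem patches_finite {K : ℕ} {ι : Type} [Finite ι] (p : ι → Fin K → ℝ) :
    (patches p).Finite := by
  refine (Set.finite_range fun s : ι → SignType =>
    {z ∈ ⋃ j, budget (p j) | position p z = s}).subset ?_
  rintro x ⟨y, -, rfl⟩
  exact ⟨position p y, rfl⟩

instance patchOn_finite {K : ℕ} {ι : Type} [Finite ι] (p : ι → Fin K → ℝ) (j : ι) :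
    Finite (PatchOn p j) :=
  ((patches_finite p).subset fun _ hx => hx.1 :
    {x | x ∈ patches p ∧ x ⊆ budget (p j)}.Finite)

theorem rationalTypes_finite {K : ℕ} {ι : Type} [Finite ι] (p : ι → Fin K → ℝ) :
    (rationalTypes p).Finite := by
  have h : {a : Row p → ℝ | ∀ r, a r ∈ ({0, 1} : Set ℝ)}.Finite :=
    Set.Finite.pi' fun _ => Set.toFinite _
  refine h.subset ?_
  rintro a ⟨d, -, rfl⟩ r
  by_cases hr : d r.1 ∈ r.2.1 <;> simp [vectorRep, Measure.real, hr]

/-- The index set of the columns of the rational demand matrix, one for each rational type. -/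
abbrev Col {K : ℕ} {ι : Type} (p : ι → Fin K → ℝ) : Type :=
  {a : Row p → ℝ // a ∈ rationalTypes p}

noncomputable instance colFintype {K : ℕ} {ι : Type} [Finite ι] (p : ι → Fin K → ℝ) :
    Fintype (Col p) :=
  (rationalTypes_finite p).fintype

/-- The rational demand matrix: its columns are the distinct vector representations of the
rationalizable nonstochastic demand systems. -/
def rationalDemandMatrix {K : ℕ} {ι : Type} (p : ι → Fin K → ℝ) : Matrix (Row p) (Col p) ℝ :=
  Matrix.of fun r a => a.1 r

/-- Put the counterfactual item, with index `0`, in front of the `J` observed ones. -/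
def augment {α : Type*} {J : ℕ} (a : α) (f : Fin J → α) : Fin (J + 1) → α :=
  Fin.cases a f

/-- The patch probabilities `π₀*` of a distribution on the counterfactual budget, with respect to
the patches of the augmented budget system. -/
noncomputable def counterfactualProbs {K J : ℕ} (p₀ : Fin K → ℝ) (p : Fin J → Fin K → ℝ)
    (P₀ : Measure (Fin K → ℝ)) : PatchOn (augment p₀ p) 0 → ℝ :=
  fun x => P₀.real x.1

/-- The patch probabilities `π₁*` of the observed demands, with respect to the patches of the
augmented budget system. -/
noncomputable def observedProbs {K J : ℕ} (p₀ : Fin K → ℝ) (p : Fin J → Fin K → ℝ)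
    (P : Fin J → Measure (Fin K → ℝ)) : (Σ j : Fin J, PatchOn (augment p₀ p) j.succ) → ℝ :=
  fun r => (P r.1).real r.2.1

/-- The stacked vector `(π₀, π₁)`: the entries of `π₀` for the counterfactual budget followed by
the entries of `π₁` for the observed budgets. -/
def stack {K J : ℕ} {p : Fin (J + 1) → Fin K → ℝ} (π₀ : PatchOn p 0 → ℝ)
    (π₁ : (Σ j : Fin J, PatchOn p j.succ) → ℝ) : Row p → ℝ :=
  fun r => Fin.cases (motive := fun j => PatchOn p j → ℝ) π₀ (fun j x => π₁ ⟨j, x⟩) r.1 r.2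

/-- The distribution `P₀` of demand at counterfactual prices `p₀` is consistent with the observed
demands: `(P₀, P₁, …, P_J)` are jointly rationalizable. -/
def Consistent {K J : ℕ} (p₀ : Fin K → ℝ) (p : Fin J → Fin K → ℝ)
    (P : Fin J → Measure (Fin K → ℝ)) (P₀ : Measure (Fin K → ℝ)) : Prop :=
  StochRationalizable (augment p₀ p) (augment P₀ P)

end RandomUtility

/-!
The key point is that rationalizability of a nonstochastic demand system depends only on the
patches in which its bundles lie (`NonstochRationalizable.of_position_eq`). The utilities of the
chosen bundles rank them consistently with all revealed preferences, local nonsatiation making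
direct preferences from the interior of a budget strict; revealed preferences are a matter of
positions relative to the budget planes; and conversely any consistent ranking extends to a locally
nonsatiated utility function, a minimum over the budgets of increasing functions of expenditure
(`nonstochRationalizable_of_ranking`).

Given a random utility model, the probabilities of the rational types are weights that reproduce
the patch probabilities (`StochRationalizable.exists_weights`). Given such weights, draw a type, and
then on each budget, independently, a bundle from the conditional distribution on the patch that the
type prescribes (`stochRationalizable_of_weights`). This has the right marginals, because the patches
partition each budget up to null sets, and by the key point it yields a rationalizable system with
probability one. Utility functions are chosen injectively in the demand system, so that demand is a
function of utility (`exists_injective_utility`, `stochRationalizable_of_joint`).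

The condition on the weights sees a distribution on the counterfactual budget only through its patch
probabilities, whence conditional distributions on patches are unrestricted.
-/

namespace RandomUtility

variable {K : ℕ} {ι : Type} {p : ι → Fin K → ℝ}

/-! ### Patches -/

theorem mem_budget_iff_position {j : ι} {y : Fin K → ℝ} :
    y ∈ budget (p j) ↔ 0 ≤ y ∧ position p y j = 0 := by
  simp [budget, position, sign_eq_zero_iff, sub_eq_zero]

theorem nonneg_of_mem_iUnion_budget {y : Fin K → ℝ} (hy : y ∈ ⋃ j, budget (p j)) : 0 ≤ y := by
  obtain ⟨j, hj⟩ := Set.mem_iUnion.1 hy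
  exact hj.1

/-- The patch of budget `j` that contains a given bundle of that budget. -/
def patchAt {j : ι} {y : Fin K → ℝ} (hy : y ∈ budget (p j)) : PatchOn p j :=
  ⟨{z ∈ ⋃ j, budget (p j) | position p z = position p y},
    ⟨y, Set.mem_iUnion.2 ⟨j, hy⟩, rfl⟩, fun _ hz => mem_budget_iff_position.2
      ⟨nonneg_of_mem_iUnion_budget hz.1, hz.2 ▸ (mem_budget_iff_position.1 hy).2⟩⟩

theorem mem_patchAt {j : ι} {y : Fin K → ℝ} (hy : y ∈ budget (p j)) : y ∈ (patchAt hy).1 :=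
  ⟨Set.mem_iUnion.2 ⟨j, hy⟩, rfl⟩

theorem position_eq_of_mem_patch {x : Set (Fin K → ℝ)} (hx : x ∈ patches p) {y z : Fin K → ℝ}
    (hy : y ∈ x) (hz : z ∈ x) : position p y = position p z := by
  obtain ⟨w, -, rfl⟩ := hx
  exact hy.2.trans hz.2.symm

theorem patches_eq_of_mem {x x' : Set (Fin K → ℝ)} (hx : x ∈ patches p) (hx' : x' ∈ patches p)
    {y : Fin K → ℝ} (hy : y ∈ x) (hy' : y ∈ x') : x = x' := by
  obtain ⟨w, -, rfl⟩ := hx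
  obtain ⟨w', -, rfl⟩ := hx'
  rw [← hy.2, ← hy'.2]

theorem pairwise_disjoint_patchOn (j : ι) :
    Pairwise (Function.onFun Disjoint fun i : PatchOn p j => i.1) := fun i i' hne =>
  Set.disjoint_left.2 fun _ hy hy' =>
    hne (Subtype.ext (patches_eq_of_mem i.2.1 i'.2.1 hy hy'))

theorem mem_patchOn_iff {j : ι} {y : Fin K → ℝ} (hy : y ∈ budget (p j)) (x : PatchOn p j) :
    y ∈ x.1 ↔ patchAt hy = x :=
  ⟨fun h => Subtype.ext (patches_eq_of_mem (patchAt hy).2.1 x.2.1 (mem_patchAt hy) h),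
    fun h => h ▸ mem_patchAt hy⟩

theorem measurable_dotProduct_left (q : Fin K → ℝ) : Measurable fun y : Fin K → ℝ => q ⬝ᵥ y :=
  (continuous_const.dotProduct continuous_id).measurable

theorem measurableSet_budget (q : Fin K → ℝ) : MeasurableSet (budget q) :=
  measurableSet_Ici.inter (measurable_dotProduct_left q (measurableSet_singleton 1))

theorem measurableSet_patch [Finite ι] {x : Set (Fin K → ℝ)} (hx : x ∈ patches p) :
    MeasurableSet x := by
  obtain ⟨w, -, rfl⟩ := hx
  refine (MeasurableSet.iUnion fun j => measurableSet_budget (p j)).inter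
    (?_ : MeasurableSet {z | position p z = position p w})
  have hsign : ∀ c : SignType, MeasurableSet {t : ℝ | SignType.sign t = c} := by
    intro c
    rcases SignType.trichotomy c with rfl | rfl | rfl
    · convert measurableSet_Iio (a := (0 : ℝ)) using 1
      ext t; exact sign_eq_neg_one_iff
    · convert measurableSet_singleton (0 : ℝ) using 1
      ext t; exact sign_eq_zero_iff
    · convert measurableSet_Ioi (a := (0 : ℝ)) using 1
      ext t; exact sign_eq_one_iff
  convert MeasurableSet.iInter fun j =>
    ((measurable_dotProduct_left (p j)).sub_const 1) (hsign (position p w j)) using 1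
  ext z
  rw [Set.mem_iInter]
  exact funext_iff

/-- A bundle of budget `j` is described by a point mass on the row of the patch it lies in. -/
theorem vectorRep_dirac [Finite ι] (d : ι → Fin K → ℝ) (r : Row p) [Decidable (d r.1 ∈ r.2.1)] :
    vectorRep p (fun j => Measure.dirac (d j)) r = if d r.1 ∈ r.2.1 then 1 else 0 := by
  have hm := measurableSet_patch r.2.2.1
  by_cases h : d r.1 ∈ r.2.1 <;> simp [vectorRep, Measure.real, h, hm]

/-! ### Measures and finite partitions -/

theorem sum_measure_inter_of_ae_mem {Ω κ : Type*} [MeasurableSpace Ω] [Fintype κ]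
    {μ : Measure Ω} {s : κ → Set Ω} (hs : ∀ i, MeasurableSet (s i))
    (hd : Pairwise (Function.onFun Disjoint s)) (hc : ∀ᵐ ω ∂μ, ∃ i, ω ∈ s i)
    {E : Set Ω} (hE : MeasurableSet E) : ∑ i, μ (s i ∩ E) = μ E := by
  rw [← tsum_fintype (L := .unconditional κ), ← measure_iUnion
    (fun i j hij => (hd hij).mono Set.inter_subset_left Set.inter_subset_left)
    (fun i => (hs i).inter hE)]
  refine measure_congr ?_
  filter_upwards [hc] with ω hω
  refine propext (?_ : (ω ∈ ⋃ i, s i ∩ E) ↔ ω ∈ E)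
  simp only [Set.mem_iUnion, Set.mem_inter_iff]
  exact ⟨fun ⟨_, h⟩ => h.2, fun h => hω.imp fun _ hi => ⟨hi, h⟩⟩

theorem ae_mem_budget {q : Fin K → ℝ} {μ : Measure (Fin K → ℝ)} [IsProbabilityMeasure μ]
    (h : μ (budget q) = 1) : ∀ᵐ y ∂μ, y ∈ budget q :=
  (prob_compl_eq_zero_iff (measurableSet_budget q)).2 h

theorem sum_measure_inter_patchOn [Finite ι] {j : ι} [Fintype (PatchOn p j)]
    {μ : Measure (Fin K → ℝ)} [IsProbabilityMeasure μ] (h : μ (budget (p j)) = 1)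
    {E : Set (Fin K → ℝ)} (hE : MeasurableSet E) : ∑ i : PatchOn p j, μ (i.1 ∩ E) = μ E := by
  refine sum_measure_inter_of_ae_mem (fun i => measurableSet_patch i.2.1)
    (pairwise_disjoint_patchOn j) ?_ hE
  filter_upwards [ae_mem_budget h] with y hy
  exact ⟨patchAt hy, mem_patchAt hy⟩

/-! ### Rationalizability of nonstochastic demand systems -/

theorem mem_argmax_iff {u : Utility K} {q y : Fin K → ℝ} (hy : 0 ≤ y) :
    y ∈ argmax u q ↔ q ⬝ᵥ y ≤ 1 ∧
      ∀ z : Bundle K, q ⬝ᵥ z.1 ≤ 1 → u.toFun z ≤ u.toFun ⟨y, hy⟩ :=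
  ⟨fun ⟨_, h, h'⟩ => ⟨h, fun z hz => h' z.1 z.2 hz⟩,
    fun ⟨h, h'⟩ => ⟨hy, h, fun z hz hqz => h' ⟨z, hz⟩ hqz⟩⟩

theorem dotProduct_one_pos {q : Fin K → ℝ} (hq : 0 ≤ q) (hne : (budget q).Nonempty) :
    0 < q ⬝ᵥ 1 := by
  rw [dotProduct_one]
  refine (Finset.sum_nonneg fun i _ => hq i).lt_of_ne fun h => ?_
  obtain ⟨y, -, hy⟩ := hne
  have h0 : q = 0 := funext fun i =>
    (Finset.sum_eq_zero_iff_of_nonneg fun i _ => hq i).1 h.symm i (Finset.mem_univ i)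
  simp [h0] at hy

/-- A ranking `r` of the chosen bundles that respects the revealed preferences, strict ones
strictly, extends to a locally nonsatiated utility function that rationalizes the choices.
The utility function is `y ↦ min_j g_j (p_j ⬝ᵥ y - 1)`, where `g_j` increases with a small slope
from below to `g_j 0 = r j` on the nonpositive half-line, and jumps above all ranks beyond it. -/
theorem nonstochRationalizable_of_ranking [Finite ι] [Nonempty ι] (hp : ∀ j, 0 ≤ p j)
    {d : ι → Fin K → ℝ} (hd : ∀ j, d j ∈ budget (p j)) (r : ι → ℝ)
    (hle : ∀ j k, p j ⬝ᵥ d k ≤ 1 → r k ≤ r j) (hlt : ∀ j k, p j ⬝ᵥ d k < 1 → r k < r j) :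
    NonstochRationalizable p d := by
  cases nonempty_fintype ι
  -- `δ` is at most the gap between any two distinct ranks
  obtain ⟨δ, hgap, hδ⟩ : ∃ δ : ℝ, (∀ i : ι × ι, r i.2 < r i.1 → δ < r i.1 - r i.2) ∧ 0 < δ := by
    have h : ∀ᶠ δ in nhdsWithin (0 : ℝ) (Set.Ioi 0),
        ∀ i : ι × ι, r i.2 < r i.1 → δ < r i.1 - r i.2 := by
      refine Filter.eventually_all.2 fun i => ?_
      by_cases hi : r i.2 < r i.1
      · filter_upwards [nhdsWithin_le_nhds (Iio_mem_nhds (sub_pos.2 hi))] with δ hδ _ using hδ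
      · exact Filter.Eventually.of_forall fun _ h => absurd h hi
    exact (h.and self_mem_nhdsWithin).exists
  obtain ⟨M, hM⟩ := (Set.finite_range r).bddAbove
  have hM' : ∀ j, r j ≤ M := fun j => hM ⟨j, rfl⟩
  let g : ι → ℝ → ℝ := fun j t => if t ≤ 0 then r j + δ * t else M + t
  have hg0 : ∀ j, g j 0 = r j := fun j => by simp [g]
  have hmono : ∀ j, StrictMono (g j) := by
    intro j s t hst
    have hj := hM' j
    by_cases ht : t ≤ 0
    · have hs : s ≤ 0 := hst.le.trans ht
      simpa [g, ht, hs] using mul_lt_mul_of_pos_left hst hδ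
    · by_cases hs : s ≤ 0
      · have := mul_nonpos_of_nonneg_of_nonpos hδ.le hs
        simp only [g, hs, ht, if_true, if_false]
        linarith [not_le.1 ht]
      · simpa [g, ht, hs] using hst
  let f : Bundle K → ℝ := fun y =>
    Finset.univ.inf' Finset.univ_nonempty fun j => g j (p j ⬝ᵥ y.1 - 1)
  have hf_le : ∀ (j : ι) (y : Bundle K), f y ≤ g j (p j ⬝ᵥ y.1 - 1) := fun j y =>
    Finset.inf'_le _ (Finset.mem_univ j)
  have hf_mono : ∀ y z : Bundle K, (∀ j, p j ⬝ᵥ y.1 < p j ⬝ᵥ z.1) → f y < f z := by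
    intro y z h
    refine (Finset.lt_inf'_iff _).2 fun j _ => (hf_le j y).trans_lt (hmono j ?_)
    linarith [h j]
  let u : Utility K :=
    { toFun := f
      nonsatiated := by
        intro y ε hε
        refine ⟨⟨y.1 + (ε / 2) • 1, add_nonneg y.2 (smul_nonneg (by positivity) zero_le_one)⟩,
          ?_, hf_mono _ _ fun j => ?_⟩
        · rw [Subtype.dist_eq, dist_eq_norm, add_sub_cancel_left]
          refine ((pi_norm_le_iff_of_nonneg (by positivity)).2 fun i => ?_).trans_lt
            (half_lt_self hε)
          simp [abs_of_pos hε]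
        · have := mul_pos (half_pos hε) (dotProduct_one_pos (hp j) ⟨d j, hd j⟩)
          rw [dotProduct_add, dotProduct_smul, smul_eq_mul]
          linarith }
  refine ⟨u, fun k => (mem_argmax_iff (hd k).1).2
    ⟨(hd k).2.le, fun z hz => ?_⟩⟩
  have hz' : f z ≤ r k := (hf_le k z).trans
    ((hmono k).monotone (sub_nonpos.2 hz) |>.trans_eq (hg0 k))
  refine hz'.trans (Finset.le_inf' Finset.univ_nonempty _ fun j _ => ?_)
  show r k ≤ g j (p j ⬝ᵥ d k - 1)
  rcases lt_trichotomy (p j ⬝ᵥ d k) 1 with h | h | h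
  · have h1 : (0 : ℝ) ≤ p j ⬝ᵥ d k := dotProduct_nonneg_of_nonneg (hp j) (hd k).1
    have h2 := hgap (j, k) (hlt j k h)
    have h3 : δ * (p j ⬝ᵥ d k) ≥ 0 := mul_nonneg hδ.le h1
    simp only [g, sub_nonpos.2 h.le, if_true]
    simp only at h2
    linarith
  · rw [h, sub_self, hg0]
    exact hle j k h.le
  · have : ¬ p j ⬝ᵥ d k - 1 ≤ 0 := by linarith
    simp only [g, this, if_false]
    linarith [hM' k]

/-- Whether a demand system is rationalizable depends only on the patches that its bundles lie in:
the ranking of the bundles by a utility function that rationalizes one system respects the revealed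
preferences of the other. -/
theorem NonstochRationalizable.of_position_eq [Finite ι] [Nonempty ι] (hp : ∀ j, 0 ≤ p j)
    {d d' : ι → Fin K → ℝ} (h : NonstochRationalizable p d) (hd' : ∀ j, 0 ≤ d' j)
    (hpos : ∀ j, position p (d' j) = position p (d j)) : NonstochRationalizable p d' := by
  obtain ⟨u, hu⟩ := h
  have hb : ∀ j, d j ∈ budget (p j) := fun j => argmax_subset_budget u (p j) (hu j)
  have hsign : ∀ j k, SignType.sign (p j ⬝ᵥ d' k - 1) = SignType.sign (p j ⬝ᵥ d k - 1) :=
    fun j k => congrFun (hpos k) j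
  have hle : ∀ j k, p j ⬝ᵥ d k ≤ 1 → u.toFun ⟨d k, (hb k).1⟩ ≤ u.toFun ⟨d j, (hb j).1⟩ :=
    fun j k hjk => ((mem_argmax_iff (hb j).1).1 (hu j)).2 ⟨d k, (hb k).1⟩ hjk
  refine nonstochRationalizable_of_ranking hp (fun j => mem_budget_iff_position.2
    ⟨hd' j, by rw [hpos]; exact (mem_budget_iff_position.1 (hb j)).2⟩)
    (fun j => u.toFun ⟨d j, (hb j).1⟩) (fun j k hjk => hle j k ?_) (fun j k hjk => ?_)
  · have h1 := sign_nonpos_iff.2 (sub_nonpos.2 hjk)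
    rw [hsign] at h1
    exact sub_nonpos.1 (sign_nonpos_iff.1 h1)
  · have h1 := sign_eq_neg_one_iff.2 (sub_neg.2 hjk)
    rw [hsign] at h1
    have h2 : p j ⬝ᵥ d k < 1 := sub_neg.1 (sign_eq_neg_one_iff.1 h1)
    refine (hle j k h2.le).lt_of_ne fun heq => ?_
    -- otherwise `d k` would be a maximizer on budget `j` in the interior of that budget
    have hk : d k ∈ argmax u (p j) := (mem_argmax_iff (hb k).1).2
      ⟨h2.le, fun z hz => by
        rw [heq]; exact ((mem_argmax_iff (hb j).1).1 (hu j)).2 z hz⟩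
    exact h2.ne (argmax_subset_budget u (p j) hk).2

/-! ### Stochastic demand systems -/

theorem rationalDemandMatrix_mulVec [Finite ι] (ν : Col p → ℝ) (r : Row p) :
    (rationalDemandMatrix p *ᵥ ν) r = ∑ a : Col p, a.1 r * ν a := rfl

/-- The weight of a rational type is the probability that the demands generated by the random
utility model are of this type. -/
theorem StochRationalizable.exists_weights [Finite ι] {P : ι → Measure (Fin K → ℝ)}
    (h : StochRationalizable p P) :
    ∃ ν ∈ stdSimplex ℝ (Col p), rationalDemandMatrix p *ᵥ ν = vectorRep p P := by
  classical
  obtain ⟨_, Pu, y, _, hy, hmax, hP⟩ := h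
  let T : Utility K → Row p → ℝ := fun u => vectorRep p fun j => Measure.dirac (y j u)
  have hT : ∀ u r, T u r = if y r.1 u ∈ r.2.1 then 1 else 0 := fun u r => vectorRep_dirac _ r
  have hev : ∀ r : Row p, MeasurableSet {u | y r.1 u ∈ r.2.1} := fun r =>
    hy r.1 (measurableSet_patch r.2.2.1)
  have hTm : Measurable T := measurable_pi_lambda _ fun r => by
    simp only [hT]
    exact Measurable.ite (hev r) measurable_const measurable_const
  have hs : ∀ a : Col p, MeasurableSet (T ⁻¹' {a.1}) := fun a => hTm (measurableSet_singleton _)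
  have hd : Pairwise (Function.onFun Disjoint fun a : Col p => T ⁻¹' {a.1}) := fun a b hab =>
    Disjoint.preimage T (Set.disjoint_singleton.2 fun h => hab (Subtype.ext h))
  have hc : ∀ᵐ u ∂Pu, ∃ a : Col p, u ∈ T ⁻¹' {a.1} := by
    filter_upwards [hmax] with u hu
    exact ⟨⟨T u, fun j => y j u, ⟨u, hu⟩, rfl⟩, rfl⟩
  have hsum : ∀ E : Set (Utility K), MeasurableSet E →
      ∑ a : Col p, Pu.real (T ⁻¹' {a.1} ∩ E) = Pu.real E := fun E hE => by
    rw [measureReal_def, ← sum_measure_inter_of_ae_mem hs hd hc hE,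
      ENNReal.toReal_sum fun _ _ => measure_ne_top _ _]
    rfl
  refine ⟨fun a => Pu.real (T ⁻¹' {a.1}), ⟨fun a => measureReal_nonneg, ?_⟩, funext fun r => ?_⟩
  · simpa using hsum Set.univ MeasurableSet.univ
  · have hr : vectorRep p P r = Pu.real {u | y r.1 u ∈ r.2.1} :=
      congrArg ENNReal.toReal (hP r.1 r.2.1 (measurableSet_patch r.2.2.1))
    rw [hr, ← hsum _ (hev r), rationalDemandMatrix_mulVec]
    refine Finset.sum_congr rfl fun a _ => ?_
    obtain ⟨d, -, had⟩ := a.2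
    have har : a.1 r = if d r.1 ∈ r.2.1 then 1 else 0 := by rw [had, vectorRep_dirac]
    by_cases hdr : d r.1 ∈ r.2.1
    · rw [if_pos hdr] at har
      rw [har, one_mul, Set.inter_eq_left.2]
      intro u (hu : T u = a.1)
      by_contra (hn : y r.1 u ∉ r.2.1)
      have := hT u r
      rw [if_neg hn, hu, har] at this
      exact one_ne_zero this
    · rw [if_neg hdr] at har
      rw [har, zero_mul, Set.disjoint_iff_inter_eq_empty.1, measureReal_empty]
      refine Set.disjoint_left.2 fun u (hu : T u = a.1) (hn : y r.1 u ∈ r.2.1) => ?_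
      have := hT u r
      rw [if_pos hn, hu, har] at this
      exact zero_ne_one this

/-- Cardinal utility: subtracting a constant changes no preferences, so the utility of the zero
bundle may be given any value. -/
def Utility.withValueAtZero (u : Utility K) (c : ℝ) : Utility K where
  toFun y := u.toFun y - u.toFun 0 + c
  nonsatiated y ε hε := by
    obtain ⟨z, hz, h⟩ := u.nonsatiated y ε hε
    exact ⟨z, hz, by linarith⟩

theorem argmax_withValueAtZero (u : Utility K) (c : ℝ) (q : Fin K → ℝ) :
    argmax (u.withValueAtZero c) q = argmax u q := by
  simp [argmax, Utility.withValueAtZero]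

/-- Rationalizing utility functions can be assigned injectively to demand systems. Utility
functions with several maximizers on a budget rationalize several demand systems; they are told
apart by the utility of the zero bundle, which carries a real number that encodes the system.
Injectivity is what allows the demand to be a function of the utility function. -/
theorem exists_injective_utility [Finite ι] [Nonempty (Utility K)] (p : ι → Fin K → ℝ) :
    ∃ U : (ι → Fin K → ℝ) → Utility K, Function.Injective U ∧
      ∀ d, NonstochRationalizable p d → ∀ j, d j ∈ argmax (U d) (p j) := by
  classical
  have := Fintype.ofFinite ι
  obtain ⟨c, hc⟩ := exists_measurableEmbedding_real (ι → Fin K → ℝ)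
  have h : ∀ d : ι → Fin K → ℝ, ∃ u : Utility K,
      NonstochRationalizable p d → ∀ j, d j ∈ argmax u (p j) := fun d => by
    by_cases hd : NonstochRationalizable p d
    · exact hd.imp fun u hu _ => hu
    · exact ⟨Classical.arbitrary _, fun h => absurd h hd⟩
  choose u hu using h
  refine ⟨fun d => (u d).withValueAtZero (c d), fun d d' h => hc.injective ?_, fun d hd j => ?_⟩
  · simpa [Utility.withValueAtZero] using congrArg (fun v : Utility K => v.toFun 0) h
  · rw [argmax_withValueAtZero]
    exact hu d hd j

/-- A distribution over demand systems that is concentrated on rationalizable ones is generated by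
a random utility model with the same joint distribution of demands. -/
theorem stochRationalizable_of_joint [Finite ι] {P : ι → Measure (Fin K → ℝ)}
    (M : Measure (ι → Fin K → ℝ)) [IsProbabilityMeasure M]
    (hM : ∀ᵐ d ∂M, NonstochRationalizable p d)
    (hP : ∀ j E, MeasurableSet E → M {d | d j ∈ E} = P j E) : StochRationalizable p P := by
  obtain ⟨d₀, u₀, -⟩ := hM.exists
  have : Nonempty (Utility K) := ⟨u₀⟩
  obtain ⟨U, hU, hmax⟩ := exists_injective_utility p
  -- utility functions carry the final σ-algebra of `U`, so that `U` and its inverse are measurable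
  let _ : MeasurableSpace (Utility K) := MeasurableSpace.map U inferInstance
  have hUm : Measurable U := fun _ h => h
  let Y : Utility K → ι → Fin K → ℝ := Function.invFun U
  have hYU : ∀ d, Y (U d) = d := Function.leftInverse_invFun hU
  have hYm : Measurable Y := fun E hE => by
    show MeasurableSet (U ⁻¹' (Y ⁻¹' E))
    rwa [← Set.preimage_comp, show Y ∘ U = id from funext hYU, Set.preimage_id]
  refine ⟨inferInstance, M.map U, fun j u => Y u j, Measure.isProbabilityMeasure_map
    hUm.aemeasurable, fun j => (measurable_pi_apply j).comp hYm, ?_, fun j E hE => ?_⟩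
  · -- the images of the rationalizable systems need not be measurable, those of a measurable
    -- subset of full measure are
    obtain ⟨S, hSsub, hSm, hS⟩ := exists_measurable_superset_of_null (ae_iff.1 hM)
    have hm : MeasurableSet (U '' Sᶜ) := by
      show MeasurableSet (U ⁻¹' (U '' Sᶜ))
      rw [Set.preimage_image_eq _ hU]
      exact hSm.compl
    have hae : ∀ᵐ u ∂M.map U, u ∈ U '' Sᶜ := by
      refine (ae_map_iff hUm.aemeasurable hm).2 ?_
      filter_upwards [compl_mem_ae_iff.2 hS] with d hd using ⟨d, hd, rfl⟩
    filter_upwards [hae]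
    rintro _ ⟨d, hd, rfl⟩ j
    rw [hYU]
    exact hmax d (not_not.1 fun h => hd (hSsub h)) j
  · rw [← hP j E hE]
    refine Eq.trans ?_ (Measure.map_apply hUm
      (((measurable_pi_apply j).comp hYm) hE)).symm
    simp [Set.preimage, hYU]

/-- Given weights on the rational types that reproduce the patch probabilities, draw a type, and
then draw the bundles on the budgets independently from the given distributions conditional on the
patches of the type. -/
theorem stochRationalizable_of_weights [Finite ι] [Nonempty ι] (hp : ∀ j, 0 ≤ p j)
    {P : ι → Measure (Fin K → ℝ)} [∀ j, IsProbabilityMeasure (P j)]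
    (hP : ∀ j, P j (budget (p j)) = 1) {ν : Col p → ℝ} (hν : ∀ a, 0 ≤ ν a)
    (h : rationalDemandMatrix p *ᵥ ν = vectorRep p P) : StochRationalizable p P := by
  classical
  cases nonempty_fintype ι
  have := fun j => Fintype.ofFinite (PatchOn p j)
  choose d hd hda using fun a : Col p => a.2
  have hdb : ∀ a j, d a j ∈ budget (p j) := fun a j => by
    obtain ⟨u, hu⟩ := hd a
    exact argmax_subset_budget u (p j) (hu j)
  let s : Col p → ∀ j, PatchOn p j := fun a j => patchAt (hdb a j)
  have hsm : ∀ a j, MeasurableSet (s a j).1 := fun a j => measurableSet_patch (s a j).2.1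
  have hsum : ∀ j (x : PatchOn p j),
      ∑ a : Col p, (if s a j = x then ENNReal.ofReal (ν a) else 0) = P j x.1 := by
    intro j x
    have h1 := congrFun h ⟨j, x⟩
    rw [rationalDemandMatrix_mulVec] at h1
    rw [← ofReal_measureReal (μ := P j) (s := x.1)]
    refine Eq.trans ?_ (congrArg ENNReal.ofReal h1)
    have ha : ∀ a : Col p, a.1 ⟨j, x⟩ = if s a j = x then 1 else 0 := fun a => by
      rw [hda a, vectorRep_dirac]
      simp only [mem_patchOn_iff (hdb a j) x, s]
    rw [ENNReal.ofReal_sum_of_nonneg fun a _ =>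
      mul_nonneg (by rw [ha]; split_ifs <;> norm_num) (hν a)]
    refine Finset.sum_congr rfl fun a _ => ?_
    rw [ha]
    split_ifs <;> simp
  let κ : Col p → ι → Measure (Fin K → ℝ) := fun a j => (P j)[|(s a j).1]
  -- a type of weight zero may prescribe a patch of probability zero, where conditioning gives the
  -- zero measure
  have hκ : ∀ a, ENNReal.ofReal (ν a) ≠ 0 → ∀ j, IsProbabilityMeasure (κ a j) := by
    intro a ha j
    refine cond_isProbabilityMeasure fun h0 => ha ?_
    have h1 := hsum j (s a j)
    rw [h0, Finset.sum_eq_zero_iff] at h1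
    simpa using h1 a (Finset.mem_univ a)
  let M : Measure (ι → Fin K → ℝ) := ∑ a : Col p, ENNReal.ofReal (ν a) • Measure.pi (κ a)
  have hM : ∀ E, M E = ∑ a : Col p, ENNReal.ofReal (ν a) * Measure.pi (κ a) E := fun E => by
    simp [M, Measure.finsetSum_apply]
  have hmarg : ∀ j E, MeasurableSet E → M {d | d j ∈ E} = P j E := by
    intro j E hE
    have h1 : ∀ a : Col p, ENNReal.ofReal (ν a) * Measure.pi (κ a) {d | d j ∈ E} =
        ∑ x : PatchOn p j, (if s a j = x then ENNReal.ofReal (ν a) else 0) * (P j)[E | x.1] := by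
      intro a
      simp only [ite_mul, zero_mul, Finset.sum_ite_eq, Finset.mem_univ, if_true]
      by_cases ha : ENNReal.ofReal (ν a) = 0
      · simp [ha]
      · have := hκ a ha
        exact congrArg _ ((measurePreserving_eval (κ a) j).measure_preimage hE.nullMeasurableSet)
    rw [hM, Finset.sum_congr rfl fun a _ => h1 a, Finset.sum_comm,
      ← sum_measure_inter_patchOn (hP j) hE]
    refine Finset.sum_congr rfl fun x _ => ?_
    rw [← Finset.sum_mul, hsum, mul_comm, cond_mul_eq_inter (measurableSet_patch x.2.1)]
  have hMprob : IsProbabilityMeasure M := by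
    obtain ⟨j⟩ := ‹Nonempty ι›
    exact ⟨by simpa using hmarg j Set.univ MeasurableSet.univ⟩
  refine stochRationalizable_of_joint M ?_ hmarg
  refine ae_iff.2 ((hM _).trans (Finset.sum_eq_zero fun a _ => ?_))
  by_cases ha : ENNReal.ofReal (ν a) = 0
  · rw [ha, zero_mul]
  · have := hκ a ha
    refine mul_eq_zero_of_right _ (ae_iff.1 ?_)
    have hae : ∀ᵐ e ∂Measure.pi (κ a), ∀ j, e j ∈ (s a j).1 :=
      Filter.eventually_all.2 fun j =>
        (measurePreserving_eval (κ a) j).quasiMeasurePreserving.ae (ae_cond_mem (hsm a j))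
    filter_upwards [hae] with e he
    exact (hd a).of_position_eq hp (fun j => ((s a j).2.2 (he j)).1) fun j =>
      position_eq_of_mem_patch (s a j).2.1 (he j) (mem_patchAt (hdb a j))

theorem stochRationalizable_iff_exists_weights [Finite ι] [Nonempty ι] (hp : ∀ j, 0 ≤ p j)
    {P : ι → Measure (Fin K → ℝ)} [∀ j, IsProbabilityMeasure (P j)]
    (hP : ∀ j, P j (budget (p j)) = 1) : StochRationalizable p P ↔
      ∃ ν ∈ stdSimplex ℝ (Col p), rationalDemandMatrix p *ᵥ ν = vectorRep p P :=
  ⟨fun h => h.exists_weights, fun ⟨_, hν, h⟩ => stochRationalizable_of_weights hp hP hν.1 h⟩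

/-! ### Counterfactual demand -/

theorem stack_eq_vectorRep {J : ℕ} (p₀ : Fin K → ℝ) (p : Fin J → Fin K → ℝ)
    (P₀ : Measure (Fin K → ℝ)) (P : Fin J → Measure (Fin K → ℝ)) :
    stack (counterfactualProbs p₀ p P₀) (observedProbs p₀ p P) =
      vectorRep (augment p₀ p) (augment P₀ P) := by
  ext ⟨j, x⟩
  induction j using Fin.cases <;> rfl

theorem consistent_iff {J : ℕ} {p₀ : Fin K → ℝ} {p : Fin J → Fin K → ℝ}
    (hp₀ : 0 ≤ p₀) (hp : ∀ j, 0 ≤ p j)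
    {P : Fin J → Measure (Fin K → ℝ)} (hPprob : ∀ j, IsProbabilityMeasure (P j))
    (hP : ∀ j, P j (budget (p j)) = 1) {P₀ : Measure (Fin K → ℝ)}
    (hP₀prob : IsProbabilityMeasure P₀) (hP₀ : P₀ (budget p₀) = 1) :
    Consistent p₀ p P P₀ ↔ ∃ ν ∈ stdSimplex ℝ (Col (augment p₀ p)),
      rationalDemandMatrix (augment p₀ p) *ᵥ ν =
        stack (counterfactualProbs p₀ p P₀) (observedProbs p₀ p P) := by
  have : ∀ j, IsProbabilityMeasure (augment P₀ P j) := Fin.cases hP₀prob hPprob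
  rw [stack_eq_vectorRep]
  exact stochRationalizable_iff_exists_weights (Fin.cases hp₀ hp) (Fin.cases hP₀ hP)

/-- Conditional distributions on the patches of a budget may be replaced at will: mix the new ones
with the old patch probabilities. -/
theorem exists_measure_with_cond [Finite ι] {j : ι} {μ : Measure (Fin K → ℝ)}
    [IsProbabilityMeasure μ] (hμ : μ (budget (p j)) = 1) (Q : PatchOn p j → Measure (Fin K → ℝ))
    (hQ : ∀ i, μ i.1 ≠ 0 → IsProbabilityMeasure (Q i) ∧ Q i i.1 = 1) :
    ∃ μ' : Measure (Fin K → ℝ), IsProbabilityMeasure μ' ∧ μ' (budget (p j)) = 1 ∧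
      ∀ i : PatchOn p j, μ' i.1 = μ i.1 ∧ (μ i.1 ≠ 0 → μ'[|i.1] = Q i) := by
  have := Fintype.ofFinite (PatchOn p j)
  let μ' : Measure (Fin K → ℝ) := ∑ i : PatchOn p j, μ i.1 • Q i
  have happ : ∀ E, μ' E = ∑ i : PatchOn p j, μ i.1 * Q i E := fun E => by
    simp [μ', Measure.finsetSum_apply]
  have htot : ∑ i : PatchOn p j, μ i.1 = 1 := by
    simpa using sum_measure_inter_patchOn hμ MeasurableSet.univ
  have hone : ∀ E, (∀ i : PatchOn p j, i.1 ⊆ E) → μ' E = 1 := fun E hE => by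
    rw [happ, ← htot]
    refine Finset.sum_congr rfl fun i _ => ?_
    by_cases hi : μ i.1 = 0
    · rw [hi, zero_mul]
    · obtain ⟨_, hi1⟩ := hQ i hi
      rw [le_antisymm prob_le_one (hi1.symm.le.trans (measure_mono (hE i))), mul_one]
  have hinter : ∀ (i : PatchOn p j) (E : Set (Fin K → ℝ)), μ' (i.1 ∩ E) = μ i.1 * Q i E := by
    intro i E
    rw [happ, Finset.sum_eq_single i]
    · by_cases hi : μ i.1 = 0
      · rw [hi, zero_mul, zero_mul]
      · obtain ⟨_, hi1⟩ := hQ i hi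
        rw [Set.inter_comm, measure_inter_conull
          ((prob_compl_eq_zero_iff (measurableSet_patch i.2.1)).2 hi1)]
    · intro k _ hk
      by_cases hμk : μ k.1 = 0
      · rw [hμk, zero_mul]
      · obtain ⟨_, hk1⟩ := hQ k hμk
        have h0 := (prob_compl_eq_zero_iff (measurableSet_patch k.2.1)).2 hk1
        have hsub : i.1 ∩ E ⊆ k.1ᶜ := fun y hy hyk =>
          Set.disjoint_left.1 (pairwise_disjoint_patchOn j hk) hyk hy.1
        rw [measure_mono_null hsub h0, mul_zero]
    · exact fun h => absurd (Finset.mem_univ i) h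
  have heq : ∀ i : PatchOn p j, μ' i.1 = μ i.1 := fun i => by
    have h1 := hinter i i.1
    rw [Set.inter_self] at h1
    by_cases hi : μ i.1 = 0
    · rw [h1, hi, zero_mul]
    · rw [h1, (hQ i hi).2, mul_one]
  refine ⟨μ', ⟨hone _ fun _ => Set.subset_univ _⟩, hone _ fun i => i.2.2, fun i => ⟨heq i, ?_⟩⟩
  intro hi
  ext E hE
  rw [cond_apply (measurableSet_patch i.2.1), hinter, heq, ← mul_assoc,
    ENNReal.inv_mul_cancel hi (measure_ne_top _ _), one_mul]

end RandomUtility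

theorem theorem2 {K J : ℕ} (p₀ : Fin K → ℝ) (p : Fin J → Fin K → ℝ)
    (hp₀ : 0 ≤ p₀) (hp : ∀ j, 0 ≤ p j)
    (P : Fin J → Measure (Fin K → ℝ)) (hPprob : ∀ j, IsProbabilityMeasure (P j))
    (hP : ∀ j, P j (RandomUtility.budget (p j)) = 1) :
    (∀ P₀ : Measure (Fin K → ℝ), IsProbabilityMeasure P₀ →
      P₀ (RandomUtility.budget p₀) = 1 →
      (RandomUtility.Consistent p₀ p P P₀ ↔
        ∃ ν ∈ stdSimplex ℝ (RandomUtility.Col (RandomUtility.augment p₀ p)),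
          RandomUtility.rationalDemandMatrix (RandomUtility.augment p₀ p) *ᵥ ν =
            RandomUtility.stack (RandomUtility.counterfactualProbs p₀ p P₀)
              (RandomUtility.observedProbs p₀ p P))) ∧
    (∀ P₀ : Measure (Fin K → ℝ), IsProbabilityMeasure P₀ →
      P₀ (RandomUtility.budget p₀) = 1 →
      RandomUtility.Consistent p₀ p P P₀ →
      ∀ Q : RandomUtility.PatchOn (RandomUtility.augment p₀ p) 0 → Measure (Fin K → ℝ),
        (∀ i, P₀ i.1 ≠ 0 → IsProbabilityMeasure (Q i) ∧ Q i i.1 = 1) →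
        ∃ P₀' : Measure (Fin K → ℝ), IsProbabilityMeasure P₀' ∧
          P₀' (RandomUtility.budget p₀) = 1 ∧
          RandomUtility.Consistent p₀ p P P₀' ∧
          ∀ i, P₀' i.1 = P₀ i.1 ∧ (P₀ i.1 ≠ 0 → P₀'[|i.1] = Q i)) := by
  refine ⟨fun P₀ hprob hb => RandomUtility.consistent_iff hp₀ hp hPprob hP hprob hb,
    fun P₀ hprob hb hcons Q hQ => ?_⟩
  obtain ⟨P₀', hprob', hb', h⟩ := RandomUtility.exists_measure_with_cond
    (p := RandomUtility.augment p₀ p) (j := 0) hb Q hQ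
  refine ⟨P₀', hprob', hb', ?_, h⟩
  have hpi : RandomUtility.counterfactualProbs p₀ p P₀' =
      RandomUtility.counterfactualProbs p₀ p P₀ :=
    funext fun i => congrArg ENNReal.toReal (h i).1
  rw [RandomUtility.consistent_iff hp₀ hp hPprob hP hprob' hb', hpi]
  exact (RandomUtility.consistent_iff hp₀ hp hPprob hP hprob hb).1 hcons
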